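/- Let $n,m\in\mathbb N$, let $f_0\colon\mathbb R^n\to\mathbb R$ and $F\colon\mathbb R^n\to\mathbb R^m$ be twice continuously differentiable, let $g\colon\mathbb R^m\to\overline{\mathbb R}$ be proper, lower semicontinuous and convex, and put $f(x,u):=f_0(x)+g(F(x)+u)$. For $h\colon\mathbb R^d\to\overline{\mathbb R}$ and $x$ with $h(x)$ finite, let $\partial h(x)=\{z\mid (z,-1)\in N_{\operatorname{epi}h}(x,h(x))\}$ and $\partial^\infty h(x)=\{z\mid (z,0)\in N_{\operatorname{epi}h}(x,h(x))\}$ denote the limiting and the singular subdifferential, where $N$ is the limiting normal cone (both sets are empty where $h$ is not finite). Define the set-valued mappings $$M(v,u):=\{x\mid v\in\partial_x f(x,u)\},\qquad M_2(v,u):=\{(x,w)\mid v\in\nabla f_0(x)+F'(x)^\top\partial g(w),\ u=w-F(x)\}$$ for $(v,u)\in\mathbb R^n\times\mathbb R^m$, where $\partial_xf(x,u)$ is the limiting subdifferential of $f(\cdot,u)$ at $x$. Let $\bar x$ satisfy $0\in\partial_xf(\bar x,0)$, and assume the qualification condition $$F'(\bar x)^\top y=0,\ y\in\partial^\infty g(F(\bar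 x))\quad\Longrightarrow\quad y=0.$$ Then there is a neighborhood $N$ of $((0,0),\bar x)$ such that for every $((v,u),x)\in N\cap\operatorname{gph}M$ the point $((v,u),(x,F(x)+u))$ belongs to $\operatorname{gph}M_2$, and each of the following properties holds for $M$ at $((v,u),x)$ if and only if it holds for $M_2$ at $((v,u),(x,F(x)+u))$: 1. isolated calmness at the point; 2. isolated calmness around the point; 3. the Aubin property at the point; 4. existence of a single-valued Lipschitz continuous localization around the point. Here, for a set-valued mapping $\Upsilon$ and $(a,b)\in\operatorname{gph}\Upsilon$: $\Upsilon$ is isolatedly calm at $(a,b)$ with constant $\kappa>0$ if there is a neighborhood $V$ of $b$ with $\|y-b\|\le\kappa\|x-a\|$ for all $x$ and all $y\in\Upsilon(x)\cap V$, and it is isolatedly calm at $(a,b)$ if this holds for some $\kappa>0$; $\Upsilon$ is isolatedly calm around $(a,b)$ if there are $\kappa>0$ and a neighborhood $W$ of $(a,b)$ such that $\Upsilon$ is isolatedly calm with constant $\kappa$ at all points of $W\cap\operatorname{gph}\Upsilon$; $\Upsilon$ has the Aubin property at $(a,b)$ if $\operatorname{gph}\Upsilon$ is locally closed at $(a,b)$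 and there are $\kappa>0$ and neighborhoods $U$ of $a$ and $V$ of $b$ such that for all $x,x'\in U$ and $y'\in\Upsilon(x')\cap V$ there is $y\in\Upsilon(x)$ with $\|y'-y\|\le\kappa\|x'-x\|$; $\Upsilon$ has a single-valued Lipschitz continuous localization around $(a,b)$ if there are neighborhoods $U$ of $a$ and $V$ of $b$ and a locally Lipschitz continuous $\upsilon\colon U\to\mathbb R^q$ (where $\mathbb R^q$ is the image space of $\Upsilon$) with $\upsilon(a)=b$ and $(U\times V)\cap\operatorname{gph}\Upsilon=\{(x,\upsilon(x))\mid x\in U\}$. -/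

import Mathlib

open Filter Topology

noncomputable section

namespace CompositeStability

/-! ### Normal cones and subdifferentials -/

section Normals

variable {H : Type*} [NormedAddCommGroup H] [InnerProductSpace ℝ H]

/-- The regular normal cone: all `η` with `⟪η, x - a⟫ ≤ o(‖x - a‖)` for `x ∈ C`. -/
def regularNormalCone (C : Set H) (a : H) : Set H :=
  {η | ∀ ε : ℝ, 0 < ε → ∀ᶠ x in 𝓝[C] a, inner ℝ η (x - a) ≤ ε * ‖x - a‖}

/-- The limiting normal cone: limits of regular normals at nearby points of `C`. -/
def limitingNormalCone (C : Set H) (a : H) : Set H :=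
  {η | ∃ (x : ℕ → H) (ξ : ℕ → H), Tendsto x atTop (𝓝 a) ∧ Tendsto ξ atTop (𝓝 η) ∧
    ∀ k, x k ∈ C ∧ ξ k ∈ regularNormalCone C (x k)}

/-- The epigraph of an extended real-valued function, as a subset of the product `H × ℝ`
equipped with its Hilbert space structure. -/
def epigraph (h : H → EReal) : Set (WithLp 2 (H × ℝ)) :=
  {p | h p.fst ≤ (p.snd : EReal)}

/-- The limiting subdifferential (empty at points where `h` is not finite). -/
def limitingSubdifferential (h : H → EReal) (a : H) : Set H :=
  {z | h a ≠ ⊤ ∧ h a ≠ ⊥ ∧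
    WithLp.toLp 2 (z, (-1 : ℝ)) ∈
      limitingNormalCone (epigraph h) (WithLp.toLp 2 (a, (h a).toReal))}

/-- The singular subdifferential (empty at points where `h` is not finite). -/
def singularSubdifferential (h : H → EReal) (a : H) : Set H :=
  {z | h a ≠ ⊤ ∧ h a ≠ ⊥ ∧
    WithLp.toLp 2 (z, (0 : ℝ)) ∈
      limitingNormalCone (epigraph h) (WithLp.toLp 2 (a, (h a).toReal))}

/-- A proper extended real-valued function. -/
def IsProper (h : H → EReal) : Prop :=
  (∃ x, h x ≠ ⊤) ∧ ∀ x, h x ≠ ⊥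

/-- Convexity of an extended real-valued function, as convexity of its epigraph. -/
def IsConvexFun (h : H → EReal) : Prop :=
  Convex ℝ (epigraph h)

end Normals

/-! ### Lipschitzian properties of set-valued mappings -/

section SetValued

variable {P Q : Type*} [NormedAddCommGroup P] [NormedAddCommGroup Q]

/-- The graph of a set-valued mapping. -/
def gph (S : P → Set Q) : Set (P × Q) :=
  {p | p.2 ∈ S p.1}

/-- `S` is isolatedly calm at `(a, b) ∈ gph S` with constant `κ`. -/
def IsolatedlyCalmAtWith (κ : ℝ) (S : P → Set Q) (a : P) (b : Q) : Prop :=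
  (a, b) ∈ gph S ∧ ∃ V ∈ 𝓝 b, ∀ x, ∀ y ∈ S x ∩ V, ‖y - b‖ ≤ κ * ‖x - a‖

/-- `S` is isolatedly calm at `(a, b) ∈ gph S`. -/
def IsolatedlyCalmAt (S : P → Set Q) (a : P) (b : Q) : Prop :=
  ∃ κ : ℝ, 0 < κ ∧ IsolatedlyCalmAtWith κ S a b

/-- `S` is isolatedly calm around (on a neighborhood of) `(a, b) ∈ gph S`: it is isolatedly calm
at all nearby points of its graph with one common constant. -/
def IsolatedlyCalmAround (S : P → Set Q) (a : P) (b : Q) : Prop :=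
  (a, b) ∈ gph S ∧ ∃ κ : ℝ, 0 < κ ∧ ∃ W ∈ 𝓝 (a, b), ∀ p ∈ W ∩ gph S,
    IsolatedlyCalmAtWith κ S p.1 p.2

/-- `S` has the Aubin property at `(a, b) ∈ gph S`; as usual in finite dimensions, local
closedness of the graph is part of the property. -/
def AubinPropertyAt (S : P → Set Q) (a : P) (b : Q) : Prop :=
  (a, b) ∈ gph S ∧
  (∃ W ∈ 𝓝 (a, b), IsClosed W ∧ IsClosed (W ∩ gph S)) ∧
  ∃ κ : ℝ, 0 < κ ∧ ∃ U ∈ 𝓝 a, ∃ V ∈ 𝓝 b, ∀ x ∈ U, ∀ x' ∈ U, ∀ y' ∈ S x' ∩ V,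
    ∃ y ∈ S x, ‖y' - y‖ ≤ κ * ‖x' - x‖

/-- `S` has a single-valued (locally) Lipschitz continuous localization around `(a, b)`. -/
def HasLipschitzLocalization (S : P → Set Q) (a : P) (b : Q) : Prop :=
  ∃ U ∈ 𝓝 a, ∃ V ∈ 𝓝 b, ∃ σ : P → Q, LocallyLipschitzOn U σ ∧ σ a = b ∧
    (U ×ˢ V) ∩ gph S = {p | p.1 ∈ U ∧ p.2 = σ p.1}

end SetValued

/-! ### The composite model and its perturbation mappings -/

section Model

variable {X Z : Type*} [NormedAddCommGroup X] [InnerProductSpace ℝ X] [CompleteSpace X]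
  [NormedAddCommGroup Z] [InnerProductSpace ℝ Z] [CompleteSpace Z]

/-- The composite function `f(x,u) = f₀(x) + g(F(x) + u)`. -/
def compositeFun (f₀ : X → ℝ) (F : X → Z) (g : Z → EReal) (x : X) (u : Z) : EReal :=
  (f₀ x : EReal) + g (F x + u)

/-- The mapping `M(v,u) = {x | v ∈ ∂ₓ f(x,u)}`, where `∂ₓ f(x,u)` is the limiting
subdifferential of `f(·,u)` at `x`. -/
def mapM (f : X → Z → EReal) (p : X × Z) : Set X :=
  {x | p.1 ∈ limitingSubdifferential (fun x' => f x' p.2) x}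

/-- The decoupled mapping
`M₂(v,u) = {(x,w) | v ∈ ∇f₀(x) + F'(x)ᵀ ∂g(w), u = w - F(x)}`. -/
def mapM₂ (f₀ : X → ℝ) (F : X → Z) (g : Z → EReal) (p : X × Z) : Set (X × Z) :=
  {q | (∃ y ∈ limitingSubdifferential g q.2,
      p.1 = gradient f₀ q.1 + ContinuousLinearMap.adjoint (fderiv ℝ F q.1) y) ∧
    p.2 = q.2 - F q.1}

/-- The qualification condition at `a`:
`F'(a)ᵀ y = 0` and `y ∈ ∂^∞ g(F(a))` imply `y = 0`. -/
def QualificationCondition (F : X → Z) (g : Z → EReal) (a : X) : Prop :=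
  ∀ y : Z, ContinuousLinearMap.adjoint (fderiv ℝ F a) y = 0 →
    y ∈ singularSubdifferential g (F a) → y = 0

end Model

end CompositeStability

end

open CompositeStability

/-! If `C` is closed and convex and `G'(p)ᵀ` annihilates no nonzero element of `N_C(G(p))`, then the
limiting normal cone of `G ⁻¹' C` at `p` is `G'(p)ᵀ N_C(G(p))`: a regular normal is approximated at
local minimizers of a penalized problem, and the condition on `G'(p)ᵀ`, being uniform on the compact
unit sphere, bounds the multipliers. The epigraph of `f(·, u)` is the preimage of `epi g` under
`(x, α) ↦ (F(x) + u, α - f₀(x))`, so that `∂ₓ f(x, u) = ∇f₀(x) + F'(x)ᵀ ∂g(F(x) + u)` whenever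
`F'(x)ᵀ` annihilates no nonzero normal to `dom g` at `F(x) + u`. At the reference point this is the
qualification condition, and it persists at nearby points. Hence `gph M₂` is, locally, the image of
`gph M` under `((v, u), x) ↦ ((v, u), (x, F(x) + u))`. The four properties depend only on the germ
of the graph, and adjoining a locally Lipschitz function of the point of the graph neither creates
nor destroys any of them. -/

namespace CompositeStability

/-! ### Lipschitzian properties depend only on the germ of the graph -/

section LocallyClosed

variable {Y Y' : Type*} [TopologicalSpace Y] [TopologicalSpace Y']

/-- Local closedness of a set at a point, in the form required by `AubinPropertyAt`. -/
def IsLocallyClosedAt (A : Set Y) (z : Y) : Prop :=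
  ∃ W ∈ 𝓝 z, IsClosed W ∧ IsClosed (W ∩ A)

lemma IsLocallyClosedAt.congr [RegularSpace Y] {A B : Set Y} {z : Y}
    (hA : IsLocallyClosedAt A z) (h : ∀ᶠ y in 𝓝 z, y ∈ A ↔ y ∈ B) : IsLocallyClosedAt B z := by
  obtain ⟨W, hWz, hW, hWA⟩ := hA
  obtain ⟨C, ⟨hCz, hC⟩, hCAB⟩ := (closed_nhds_basis z).mem_iff.1 h
  refine ⟨W ∩ C, inter_mem hWz hCz, hW.inter hC, ?_⟩
  have hWCB : W ∩ C ∩ B = W ∩ A ∩ C := by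
    ext y
    have : y ∈ C → (y ∈ A ↔ y ∈ B) := fun hy => hCAB hy
    simp only [Set.mem_inter_iff]
    tauto
  exact hWCB ▸ hWA.inter hC

lemma IsLocallyClosedAt.preimage {A : Set Y} {f : Y' → Y} {z : Y'}
    (hA : IsLocallyClosedAt A (f z)) (hf : Continuous f) : IsLocallyClosedAt (f ⁻¹' A) z := by
  obtain ⟨W, hWz, hW, hWA⟩ := hA
  exact ⟨f ⁻¹' W, hf.continuousAt hWz, hW.preimage hf, hWA.preimage hf⟩

lemma IsLocallyClosedAt.inter_isClosed {A B : Set Y} {z : Y} (hA : IsLocallyClosedAt A z)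
    (hB : IsClosed B) : IsLocallyClosedAt (A ∩ B) z := by
  obtain ⟨W, hWz, hW, hWA⟩ := hA
  exact ⟨W, hWz, hW, Set.inter_assoc W A B ▸ hWA.inter hB⟩

end LocallyClosed

section Germ

variable {P Q : Type*} [NormedAddCommGroup P] [NormedAddCommGroup Q]
  {S T : P → Set Q} {a : P} {b : Q}

lemma isolatedlyCalmAtWith_iff_eventually {κ : ℝ} (hκ : 0 < κ) :
    IsolatedlyCalmAtWith κ S a b ↔
      (a, b) ∈ gph S ∧ ∀ᶠ z in 𝓝 (a, b), z ∈ gph S → ‖z.2 - b‖ ≤ κ * ‖z.1 - a‖ := by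
  refine and_congr_right fun _ => ⟨?_, fun h => ?_⟩
  · rintro ⟨V, hV, hcalm⟩
    filter_upwards [continuousAt_snd.preimage_mem_nhds hV] with z hzV hz
    exact hcalm z.1 z.2 ⟨hz, hzV⟩
  · obtain ⟨δ, hδ, hball⟩ := Metric.eventually_nhds_iff_ball.1 h
    refine ⟨Metric.ball b (min δ (κ * δ)), Metric.ball_mem_nhds b (by positivity), ?_⟩
    rintro x y ⟨hy, hyb⟩
    rw [mem_ball_iff_norm, lt_min_iff] at hyb
    rcases lt_or_ge ‖x - a‖ δ with hx | hx
    · refine hball (x, y) ?_ hy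
      rw [← ball_prod_same]
      exact ⟨mem_ball_iff_norm.2 hx, mem_ball_iff_norm.2 hyb.1⟩
    -- far from `a` the estimate holds because `V` has been shrunk to radius `κ * δ`
    · exact hyb.2.le.trans (by gcongr)

lemma isolatedlyCalmAtWith_congr {κ : ℝ} (hκ : 0 < κ)
    (h : ∀ᶠ z in 𝓝 (a, b), z ∈ gph S ↔ z ∈ gph T) :
    IsolatedlyCalmAtWith κ S a b ↔ IsolatedlyCalmAtWith κ T a b := by
  rw [isolatedlyCalmAtWith_iff_eventually hκ, isolatedlyCalmAtWith_iff_eventually hκ,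
    h.self_of_nhds]
  exact and_congr_right fun _ => eventually_congr (h.mono fun z hz => by rw [hz])

lemma isolatedlyCalmAt_congr (h : ∀ᶠ z in 𝓝 (a, b), z ∈ gph S ↔ z ∈ gph T) :
    IsolatedlyCalmAt S a b ↔ IsolatedlyCalmAt T a b :=
  exists_congr fun _ => and_congr_right fun hκ => isolatedlyCalmAtWith_congr hκ h

lemma isolatedlyCalmAround_iff_eventually :
    IsolatedlyCalmAround S a b ↔
      (a, b) ∈ gph S ∧ ∃ κ : ℝ, 0 < κ ∧
        ∀ᶠ z in 𝓝 (a, b), z ∈ gph S → IsolatedlyCalmAtWith κ S z.1 z.2 := by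
  simp only [IsolatedlyCalmAround, eventually_iff_exists_mem, Set.mem_inter_iff, and_imp]

lemma isolatedlyCalmAround_congr (h : ∀ᶠ z in 𝓝 (a, b), z ∈ gph S ↔ z ∈ gph T) :
    IsolatedlyCalmAround S a b ↔ IsolatedlyCalmAround T a b := by
  rw [isolatedlyCalmAround_iff_eventually, isolatedlyCalmAround_iff_eventually, h.self_of_nhds]
  refine and_congr_right fun _ => exists_congr fun κ => and_congr_right fun hκ =>
    eventually_congr ?_
  filter_upwards [h.eventually_nhds] with z hz
  rw [hz.self_of_nhds, isolatedlyCalmAtWith_congr hκ hz]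

lemma aubinPropertyAt_iff_eventually :
    AubinPropertyAt S a b ↔
      (a, b) ∈ gph S ∧ IsLocallyClosedAt (gph S) (a, b) ∧
        ∃ κ : ℝ, 0 < κ ∧ ∀ᶠ t : P × P × Q in 𝓝 (a, a, b), t.2.2 ∈ S t.2.1 →
          ∃ y ∈ S t.1, ‖t.2.2 - y‖ ≤ κ * ‖t.2.1 - t.1‖ := by
  refine and_congr_right fun _ => and_congr_right fun _ => exists_congr fun κ =>
    and_congr_right fun _ => ⟨?_, fun h => ?_⟩
  · rintro ⟨U, hU, V, hV, hSUV⟩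
    filter_upwards [prod_mem_nhds hU (prod_mem_nhds hU hV)] with t ht hmem
    exact hSUV t.1 ht.1 t.2.1 ht.2.1 t.2.2 ⟨hmem, ht.2.2⟩
  · obtain ⟨U₁, hU₁, A, hA, hU₁A⟩ := mem_nhds_prod_iff.1 h
    obtain ⟨U₂, hU₂, V, hV, hU₂V⟩ := mem_nhds_prod_iff.1 hA
    refine ⟨U₁ ∩ U₂, inter_mem hU₁ hU₂, V, hV, fun x hx x' hx' y' hy' => ?_⟩
    exact hU₁A (show (x, x', y') ∈ U₁ ×ˢ A from ⟨hx.1, hU₂V ⟨hx'.2, hy'.2⟩⟩) hy'.1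

/-- Applied to an Aubin estimate: the point `y` which it furnishes is automatically close to the
reference point `b`. -/
lemma eventually_forall_norm_sub_le_imp (κ : ℝ) {p : Q → Prop} (hp : ∀ᶠ y in 𝓝 b, p y) :
    ∀ᶠ t : P × P × Q in 𝓝 (a, a, b), ∀ y, ‖t.2.2 - y‖ ≤ κ * ‖t.2.1 - t.1‖ → p y := by
  obtain ⟨r, hr, hball⟩ := Metric.eventually_nhds_iff_ball.1 hp
  have hcont : Continuous fun t : P × P × Q => ‖t.2.2 - b‖ + κ * ‖t.2.1 - t.1‖ := by fun_prop
  have hsmall := hcont.tendsto (a, a, b)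
  simp only [sub_self, norm_zero, mul_zero, add_zero] at hsmall
  filter_upwards [hsmall.eventually (gt_mem_nhds hr)] with t ht y hy
  refine hball y (mem_ball_iff_norm.2 ?_)
  calc ‖y - b‖ ≤ ‖y - t.2.2‖ + ‖t.2.2 - b‖ := norm_sub_le_norm_sub_add_norm_sub y t.2.2 b
    _ ≤ ‖t.2.2 - b‖ + κ * ‖t.2.1 - t.1‖ := by rw [norm_sub_rev y]; linarith
    _ < r := ht

lemma AubinPropertyAt.congr (hS : AubinPropertyAt S a b)
    (h : ∀ᶠ z in 𝓝 (a, b), z ∈ gph S ↔ z ∈ gph T) : AubinPropertyAt T a b := by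
  rw [aubinPropertyAt_iff_eventually] at hS ⊢
  obtain ⟨hmem, hclosed, κ, hκ, hest⟩ := hS
  refine ⟨h.self_of_nhds.1 hmem, hclosed.congr h, κ, hκ, ?_⟩
  obtain ⟨pU, hpU, pV, hpV, hpUV⟩ := eventually_prod_iff.1 (nhds_prod_eq (x := a) (y := b) ▸ h)
  have hfst : Tendsto (fun t : P × P × Q => t.1) (𝓝 (a, a, b)) (𝓝 a) := continuousAt_fst
  have hsnd : Tendsto (fun t : P × P × Q => t.2) (𝓝 (a, a, b)) (𝓝 (a, b)) := continuousAt_snd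
  filter_upwards [hest, hfst.eventually hpU, hsnd.eventually h,
    eventually_forall_norm_sub_le_imp κ hpV] with t ht ht₁ ht₂ hnear hmemT
  obtain ⟨y, hy, hle⟩ := ht (ht₂.2 hmemT)
  exact ⟨y, (hpUV ht₁ (hnear y hle)).1 hy, hle⟩

lemma aubinPropertyAt_congr (h : ∀ᶠ z in 𝓝 (a, b), z ∈ gph S ↔ z ∈ gph T) :
    AubinPropertyAt S a b ↔ AubinPropertyAt T a b :=
  ⟨fun hS => hS.congr h, fun hT => hT.congr (h.mono fun _ hz => hz.symm)⟩

lemma hasLipschitzLocalization_iff_eventually :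
    HasLipschitzLocalization S a b ↔
      ∃ σ : P → Q, (∃ K, ∃ U ∈ 𝓝 a, LipschitzOnWith K σ U) ∧ σ a = b ∧
        ∀ᶠ z in 𝓝 (a, b), z ∈ gph S ↔ z.2 = σ z.1 := by
  constructor
  · rintro ⟨U, hU, V, hV, σ, hσ, hσa, hgph⟩
    obtain ⟨K, U', hU', hσU'⟩ := hσ (mem_of_mem_nhds hU)
    refine ⟨σ, ⟨K, U', nhdsWithin_eq_nhds.2 hU ▸ hU', hσU'⟩, hσa, ?_⟩
    filter_upwards [prod_mem_nhds hU hV] with z hz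
    have := Set.ext_iff.1 hgph z
    exact ⟨fun hzS => (this.1 ⟨hz, hzS⟩).2, fun hzσ => (this.2 ⟨hz.1, hzσ⟩).2⟩
  · rintro ⟨σ, ⟨K, U, hU, hσ⟩, hσa, hgph⟩
    obtain ⟨A, hA, B, hB, hAB⟩ := mem_nhds_prod_iff.1 hgph
    have hσB : σ ⁻¹' B ∈ 𝓝 a := hσ.continuousOn.continuousAt hU (hσa.symm ▸ hB)
    refine ⟨U ∩ A ∩ σ ⁻¹' B, inter_mem (inter_mem hU hA) hσB, B, hB, σ,
      fun x _ => ⟨K, _, self_mem_nhdsWithin, hσ.mono fun x hx => hx.1.1⟩, hσa, ?_⟩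
    ext ⟨x, y⟩
    constructor
    · rintro ⟨⟨hx, hy⟩, hxy⟩
      exact ⟨hx, (hAB ⟨hx.1.2, hy⟩).1 hxy⟩
    · rintro ⟨hx, rfl : y = σ x⟩
      exact ⟨⟨hx, hx.2⟩, (hAB (show (x, σ x) ∈ A ×ˢ B from ⟨hx.1.2, hx.2⟩)).2 rfl⟩

lemma hasLipschitzLocalization_congr (h : ∀ᶠ z in 𝓝 (a, b), z ∈ gph S ↔ z ∈ gph T) :
    HasLipschitzLocalization S a b ↔ HasLipschitzLocalization T a b := by
  rw [hasLipschitzLocalization_iff_eventually, hasLipschitzLocalization_iff_eventually]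
  exact exists_congr fun σ => and_congr_right fun _ => and_congr_right fun _ =>
    eventually_congr (h.mono fun z hz => by rw [hz])

end Germ

/-! ### Adjoining a Lipschitz function of the graph -/

section GraphicalLift

variable {P Q R : Type*} {Φ : P × Q → R} {S : P → Set Q}

/-- The set-valued mapping whose graph is the image of `gph S` under `(x, y) ↦ (x, (y, Φ (x, y)))`.
The mapping `M₂` arises in this way from a mapping in the variable `x` alone, with
`Φ ((v, u), x) = F x + u`. -/
def graphicalLift (Φ : P × Q → R) (S : P → Set Q) (x : P) : Set (Q × R) :=
  {q | q.1 ∈ S x ∧ q.2 = Φ (x, q.1)}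

lemma mem_gph_graphicalLift_graph {z : P × Q} :
    (z.1, z.2, Φ z) ∈ gph (graphicalLift Φ S) ↔ z ∈ gph S :=
  and_iff_left rfl

variable [NormedAddCommGroup P] [NormedAddCommGroup Q] [NormedAddCommGroup R]
  {a : P} {b : Q} {κ : ℝ}

lemma tendsto_prodMk_fst_snd_fst (c : R) :
    Tendsto (fun z : P × Q × R => (z.1, z.2.1)) (𝓝 (a, b, c)) (𝓝 (a, b)) :=
  Continuous.tendsto (by fun_prop) (a, b, c)

lemma tendsto_graph_of_continuousAt (hΦ : ContinuousAt Φ (a, b)) :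
    Tendsto (fun z : P × Q => (z.1, z.2, Φ z)) (𝓝 (a, b)) (𝓝 (a, b, Φ (a, b))) :=
  continuousAt_fst.prodMk_nhds (continuousAt_snd.prodMk_nhds hΦ)

lemma norm_graph_sub_graph_le {K : NNReal} {U : Set (P × Q)} (hΦ : LipschitzOnWith K Φ U)
    {z z' : P × Q} (hz : z ∈ U) (hz' : z' ∈ U) (hle : ‖z.2 - z'.2‖ ≤ κ * ‖z.1 - z'.1‖) :
    ‖(z.2, Φ z) - (z'.2, Φ z')‖ ≤ max κ (K * max 1 κ) * ‖z.1 - z'.1‖ := by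
  have hΦle : ‖Φ z - Φ z'‖ ≤ K * max 1 κ * ‖z.1 - z'.1‖ :=
    calc ‖Φ z - Φ z'‖ ≤ K * max ‖z.1 - z'.1‖ ‖z.2 - z'.2‖ := hΦ.norm_sub_le hz hz'
      _ ≤ K * max (1 * ‖z.1 - z'.1‖) (κ * ‖z.1 - z'.1‖) := by rw [one_mul]; gcongr
      _ = K * max 1 κ * ‖z.1 - z'.1‖ := by
        rw [← max_mul_of_nonneg _ _ (norm_nonneg _), mul_assoc]
  rw [max_mul_of_nonneg _ _ (norm_nonneg _)]
  exact max_le_max hle hΦle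

lemma IsolatedlyCalmAtWith.lift {K : NNReal} {U : Set (P × Q)}
    (hΦ : LipschitzOnWith K Φ U) (hU : U ∈ 𝓝 (a, b)) (hκ : 0 < κ)
    (hS : IsolatedlyCalmAtWith κ S a b) :
    IsolatedlyCalmAtWith (max κ (K * max 1 κ)) (graphicalLift Φ S) a (b, Φ (a, b)) := by
  rw [isolatedlyCalmAtWith_iff_eventually (lt_max_of_lt_left hκ)]
  rw [isolatedlyCalmAtWith_iff_eventually hκ] at hS
  refine ⟨mem_gph_graphicalLift_graph.2 hS.1, ?_⟩
  filter_upwards [(tendsto_prodMk_fst_snd_fst (Φ (a, b))).eventually (hS.2.and hU)]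
  rintro ⟨x, y, w⟩ ⟨hle, hxyU⟩ ⟨hy, rfl : w = Φ (x, y)⟩
  exact norm_graph_sub_graph_le hΦ hxyU (mem_of_mem_nhds hU) (hle hy)

lemma IsolatedlyCalmAtWith.of_lift (hΦ : ContinuousAt Φ (a, b)) (hκ : 0 < κ)
    (hS : IsolatedlyCalmAtWith κ (graphicalLift Φ S) a (b, Φ (a, b))) :
    IsolatedlyCalmAtWith κ S a b := by
  rw [isolatedlyCalmAtWith_iff_eventually hκ] at hS ⊢
  refine ⟨mem_gph_graphicalLift_graph.1 hS.1, ?_⟩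
  filter_upwards [(tendsto_graph_of_continuousAt hΦ).eventually hS.2] with z hz hzS
  exact (norm_fst_le ((z.2, Φ z) - (b, Φ (a, b)))).trans
    (hz (mem_gph_graphicalLift_graph.2 hzS))

lemma isolatedlyCalmAt_graphicalLift_iff (hΦ : LocallyLipschitz Φ) :
    IsolatedlyCalmAt (graphicalLift Φ S) a (b, Φ (a, b)) ↔ IsolatedlyCalmAt S a b := by
  constructor
  · rintro ⟨κ, hκ, hcalm⟩
    exact ⟨κ, hκ, hcalm.of_lift hΦ.continuous.continuousAt hκ⟩
  · rintro ⟨κ, hκ, hcalm⟩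
    obtain ⟨K, U, hU, hΦU⟩ := hΦ (a, b)
    exact ⟨_, lt_max_of_lt_left hκ, hcalm.lift hΦU hU hκ⟩

lemma isolatedlyCalmAround_graphicalLift_iff (hΦ : LocallyLipschitz Φ) :
    IsolatedlyCalmAround (graphicalLift Φ S) a (b, Φ (a, b)) ↔ IsolatedlyCalmAround S a b := by
  rw [isolatedlyCalmAround_iff_eventually, isolatedlyCalmAround_iff_eventually]
  refine and_congr (mem_gph_graphicalLift_graph (z := (a, b))) ⟨?_, ?_⟩
  · rintro ⟨κ, hκ, hcalm⟩
    refine ⟨κ, hκ, ?_⟩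
    have hΦc := hΦ.continuous.continuousAt (x := (a, b))
    filter_upwards [(tendsto_graph_of_continuousAt hΦc).eventually hcalm] with z hz hzS
    exact (hz (mem_gph_graphicalLift_graph.2 hzS)).of_lift
      hΦ.continuous.continuousAt hκ
  · rintro ⟨κ, hκ, hcalm⟩
    obtain ⟨K, U, hU, hΦU⟩ := hΦ (a, b)
    refine ⟨max κ (K * max 1 κ), lt_max_of_lt_left hκ, ?_⟩
    filter_upwards [(tendsto_prodMk_fst_snd_fst (Φ (a, b))).eventually
      (hcalm.and (eventually_mem_nhds_iff.2 hU))]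
    rintro ⟨x, y, w⟩ ⟨hxy, hxyU⟩ ⟨hy, rfl : w = Φ (x, y)⟩
    exact (hxy hy).lift hΦU hxyU hκ

lemma isLocallyClosedAt_gph_graphicalLift_iff (hΦ : Continuous Φ) :
    IsLocallyClosedAt (gph (graphicalLift Φ S)) (a, b, Φ (a, b)) ↔
      IsLocallyClosedAt (gph S) (a, b) := by
  constructor
  · intro h
    have hpre : (fun z : P × Q => (z.1, z.2, Φ z)) ⁻¹' gph (graphicalLift Φ S) = gph S :=
      Set.ext fun _ => mem_gph_graphicalLift_graph
    exact hpre ▸ h.preimage (f := fun z : P × Q => (z.1, z.2, Φ z)) (by fun_prop)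
  · intro h
    have hS : IsLocallyClosedAt ((fun z : P × Q × R => (z.1, z.2.1)) ⁻¹' gph S)
        (a, b, Φ (a, b)) := IsLocallyClosedAt.preimage h (by fun_prop)
    have hgraph : IsClosed {z : P × Q × R | z.2.2 = Φ (z.1, z.2.1)} :=
      isClosed_eq (by fun_prop) (by fun_prop)
    exact hS.inter_isClosed hgraph

lemma AubinPropertyAt.lift (hΦ : LocallyLipschitz Φ) (hS : AubinPropertyAt S a b) :
    AubinPropertyAt (graphicalLift Φ S) a (b, Φ (a, b)) := by
  rw [aubinPropertyAt_iff_eventually] at hS ⊢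
  obtain ⟨hmem, hclosed, κ, hκ, hest⟩ := hS
  refine ⟨mem_gph_graphicalLift_graph.2 hmem,
    (isLocallyClosedAt_gph_graphicalLift_iff hΦ.continuous).2 hclosed, ?_⟩
  obtain ⟨K, U, hU, hΦU⟩ := hΦ (a, b)
  obtain ⟨A, hA, B, hB, hAB⟩ := mem_nhds_prod_iff.1 hU
  refine ⟨max κ (K * max 1 κ), lt_max_of_lt_left hκ, ?_⟩
  have hforget : Tendsto (fun t : P × P × Q × R => (t.1, t.2.1, t.2.2.1))
      (𝓝 (a, a, b, Φ (a, b))) (𝓝 (a, a, b)) :=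
    Continuous.tendsto (by fun_prop) (a, a, b, Φ (a, b))
  have hfst : Tendsto (fun t : P × P × Q => t.1) (𝓝 (a, a, b)) (𝓝 a) := continuousAt_fst
  have hsnd : Tendsto (fun t : P × P × Q => t.2) (𝓝 (a, a, b)) (𝓝 (a, b)) := continuousAt_snd
  filter_upwards [hforget.eventually (hest.and ((hfst.eventually hA).and
    ((hsnd.eventually hU).and (eventually_forall_norm_sub_le_imp κ hB))))]
  rintro ⟨x, x', y', w'⟩ ⟨hxy, hx, hxyU, hnear⟩ ⟨hy', rfl : w' = Φ (x', y')⟩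
  obtain ⟨y, hy, hle⟩ := hxy hy'
  exact ⟨(y, Φ (x, y)), ⟨hy, rfl⟩,
    norm_graph_sub_graph_le (z := (x', y')) (z' := (x, y)) hΦU hxyU
      (hAB ⟨hx, hnear y hle⟩) hle⟩

lemma AubinPropertyAt.of_lift (hΦ : Continuous Φ)
    (hS : AubinPropertyAt (graphicalLift Φ S) a (b, Φ (a, b))) : AubinPropertyAt S a b := by
  rw [aubinPropertyAt_iff_eventually] at hS ⊢
  obtain ⟨hmem, hclosed, κ, hκ, hest⟩ := hS
  refine ⟨mem_gph_graphicalLift_graph.1 hmem,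
    (isLocallyClosedAt_gph_graphicalLift_iff hΦ).1 hclosed, κ, hκ, ?_⟩
  have hgraph : Tendsto (fun t : P × P × Q => (t.1, t.2.1, t.2.2, Φ t.2))
      (𝓝 (a, a, b)) (𝓝 (a, a, b, Φ (a, b))) :=
    Continuous.tendsto (by fun_prop) (a, a, b)
  filter_upwards [hgraph.eventually hest] with t ht hy'
  obtain ⟨q, hq, hle⟩ := ht ⟨hy', rfl⟩
  exact ⟨q.1, hq.1, (norm_fst_le ((t.2.2, Φ t.2) - q)).trans hle⟩

lemma aubinPropertyAt_graphicalLift_iff (hΦ : LocallyLipschitz Φ) :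
    AubinPropertyAt (graphicalLift Φ S) a (b, Φ (a, b)) ↔ AubinPropertyAt S a b :=
  ⟨fun h => h.of_lift hΦ.continuous, fun h => h.lift hΦ⟩

lemma HasLipschitzLocalization.lift (hΦ : LocallyLipschitz Φ)
    (hS : HasLipschitzLocalization S a b) :
    HasLipschitzLocalization (graphicalLift Φ S) a (b, Φ (a, b)) := by
  rw [hasLipschitzLocalization_iff_eventually] at hS ⊢
  obtain ⟨σ, ⟨K, U, hU, hσ⟩, rfl, hgph⟩ := hS
  obtain ⟨L, W, hW, hΦW⟩ := hΦ (a, σ a)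
  have hσgraph : LipschitzOnWith (max 1 K) (fun x => (x, σ x)) U :=
    LipschitzWith.id.lipschitzOnWith.prodMk hσ
  have hUW : U ∩ (fun x => (x, σ x)) ⁻¹' W ∈ 𝓝 a :=
    inter_mem hU (hσgraph.continuousOn.continuousAt hU hW)
  refine ⟨fun x => (σ x, Φ (x, σ x)), ⟨_, _, hUW, (hσ.mono Set.inter_subset_left).prodMk
    (hΦW.comp (hσgraph.mono Set.inter_subset_left) fun x hx => hx.2)⟩, rfl, ?_⟩
  filter_upwards [(tendsto_prodMk_fst_snd_fst (Φ (a, σ a))).eventually hgph]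
  rintro ⟨x, y, w⟩ hxy
  have hxy' : y ∈ S x ↔ y = σ x := hxy
  simp only [gph, graphicalLift, Set.mem_ofPred_eq, Prod.mk.injEq, hxy']
  exact and_congr_right fun h => h ▸ Iff.rfl

lemma HasLipschitzLocalization.of_lift (hΦ : ContinuousAt Φ (a, b))
    (hS : HasLipschitzLocalization (graphicalLift Φ S) a (b, Φ (a, b))) :
    HasLipschitzLocalization S a b := by
  rw [hasLipschitzLocalization_iff_eventually] at hS ⊢
  obtain ⟨σ, ⟨K, U, hU, hσ⟩, hσa, hgph⟩ := hS
  have hσgraph : Tendsto (fun z : P × Q => (z.1, σ z.1)) (𝓝 (a, b)) (𝓝 (a, b, Φ (a, b))) :=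
    continuousAt_fst.prodMk_nhds
      (hσa ▸ (hσ.continuousOn.continuousAt hU).tendsto.comp continuousAt_fst)
  refine ⟨fun x => (σ x).1, ⟨1 * K, U, hU, LipschitzWith.prod_fst.comp_lipschitzOnWith hσ⟩,
    congrArg Prod.fst hσa, ?_⟩
  filter_upwards [(tendsto_graph_of_continuousAt hΦ).eventually hgph,
    hσgraph.eventually hgph] with z hz hzσ
  refine ⟨fun hzS => congrArg Prod.fst (hz.1 (mem_gph_graphicalLift_graph.2 hzS)), fun hzσ₁ => ?_⟩
  have hmem : (z.1, σ z.1) ∈ gph (graphicalLift Φ S) := hzσ.2 rfl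
  have hz₂ : z.2 ∈ S z.1 := hzσ₁ ▸ hmem.1
  exact hz₂

lemma hasLipschitzLocalization_graphicalLift_iff (hΦ : LocallyLipschitz Φ) :
    HasLipschitzLocalization (graphicalLift Φ S) a (b, Φ (a, b)) ↔
      HasLipschitzLocalization S a b :=
  ⟨fun h => h.of_lift hΦ.continuous.continuousAt, fun h => h.lift hΦ⟩

end GraphicalLift

/-! ### Normal cones of convex sets -/

section ConvexNormals

variable {H : Type*} [NormedAddCommGroup H] [InnerProductSpace ℝ H] {C : Set H} {a η : H}

/-- The normal cone of convex analysis, with which the limiting normal cone of a convex set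
coincides. Being the intersection of closed conditions on `(a, η)`, it is much easier to pass to
the limit in. As for `limitingNormalCone`, the point `a` is not required to lie in `C`. -/
def convexNormalCone (C : Set H) (a : H) : Set H :=
  {η | ∀ c ∈ C, inner ℝ η (c - a) ≤ 0}

lemma smul_mem_convexNormalCone {r : ℝ} (hr : 0 ≤ r) (hη : η ∈ convexNormalCone C a) :
    r • η ∈ convexNormalCone C a := fun c hc => by
  rw [real_inner_smul_left]
  exact mul_nonpos_of_nonneg_of_nonpos hr (hη c hc)

lemma isClosed_gph_convexNormalCone (C : Set H) : IsClosed (gph (convexNormalCone C)) := by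
  have hInter : gph (convexNormalCone C) = ⋂ c ∈ C, {z : H × H | inner ℝ z.2 (c - z.1) ≤ 0} := by
    ext z
    simp only [gph, convexNormalCone, Set.mem_ofPred_eq, Set.mem_iInter]
  exact hInter ▸ isClosed_biInter fun c _ => isClosed_le (by fun_prop) continuous_const

lemma convexNormalCone_subset_regularNormalCone (C : Set H) (a : H) :
    convexNormalCone C a ⊆ regularNormalCone C a := by
  intro η hη ε hε
  filter_upwards [self_mem_nhdsWithin] with x hx
  exact (hη x hx).trans (by positivity)

lemma regularNormalCone_subset_limitingNormalCone (ha : a ∈ C) :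
    regularNormalCone C a ⊆ limitingNormalCone C a := fun η hη =>
  ⟨fun _ => a, fun _ => η, tendsto_const_nhds, tendsto_const_nhds, fun _ => ⟨ha, hη⟩⟩

lemma tendsto_add_smul_nhdsGT_zero {E : Type*} [NormedAddCommGroup E] [NormedSpace ℝ E]
    (a d : E) : Tendsto (fun t : ℝ => a + t • d) (𝓝[>] 0) (𝓝 a) := by
  have hcont : Continuous fun t : ℝ => a + t • d := by fun_prop
  simpa only [zero_smul, add_zero] using (hcont.tendsto 0).mono_left nhdsWithin_le_nhds

lemma regularNormalCone_subset_convexNormalCone (hC : Convex ℝ C) (ha : a ∈ C) :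
    regularNormalCone C a ⊆ convexNormalCone C a := by
  intro η hη c hc
  have hsegment : Tendsto (fun t : ℝ => a + t • (c - a)) (𝓝[>] 0) (𝓝[C] a) := by
    refine tendsto_nhdsWithin_iff.2 ⟨tendsto_add_smul_nhdsGT_zero a (c - a), ?_⟩
    filter_upwards [Ioo_mem_nhdsGT (zero_lt_one' ℝ)] with t ht
    exact hC.add_smul_sub_mem ha hc ⟨ht.1.le, ht.2.le⟩
  have hle : ∀ ε : ℝ, 0 < ε → inner ℝ η (c - a) ≤ ε * ‖c - a‖ := by
    intro ε hε
    obtain ⟨t, hηt, ht : 0 < t⟩ :=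
      ((hsegment.eventually (hη ε hε)).and self_mem_nhdsWithin).exists
    rw [add_sub_cancel_left, real_inner_smul_right, norm_smul, Real.norm_of_nonneg ht.le,
      mul_left_comm] at hηt
    exact le_of_mul_le_mul_left hηt ht
  have hlim : Tendsto (fun ε : ℝ => ε * ‖c - a‖) (𝓝[>] 0) (𝓝 0) := by
    simpa only [zero_add, smul_eq_mul, mul_zero] using
      tendsto_add_smul_nhdsGT_zero (0 : ℝ) ‖c - a‖
  exact ge_of_tendsto hlim (eventually_mem_nhdsWithin.mono hle)

lemma limitingNormalCone_eq_convexNormalCone (hC : Convex ℝ C) (ha : a ∈ C) :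
    limitingNormalCone C a = convexNormalCone C a := by
  refine Set.Subset.antisymm ?_ ((convexNormalCone_subset_regularNormalCone C a).trans
    (regularNormalCone_subset_limitingNormalCone ha))
  rintro η ⟨x, ξ, hx, hξ, hmem⟩
  exact (isClosed_gph_convexNormalCone C).mem_of_tendsto (hx.prodMk_nhds hξ)
    (Eventually.of_forall fun k =>
      regularNormalCone_subset_convexNormalCone hC (hmem k).1 (hmem k).2)

lemma exists_infDist_eq_norm_sub_mem_convexNormalCone [CompleteSpace H] (hne : C.Nonempty)
    (hclosed : IsClosed C) (hC : Convex ℝ C) (x : H) :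
    ∃ c ∈ C, Metric.infDist x C = ‖x - c‖ ∧ x - c ∈ convexNormalCone C c := by
  obtain ⟨c, hc, hmin⟩ := exists_norm_eq_iInf_of_complete_convex hne hclosed.isComplete hC x
  refine ⟨c, hc, ?_, (norm_eq_iInf_iff_real_inner_le_zero hC hc).1 hmin⟩
  simp only [hmin, Metric.infDist_eq_iInf, dist_eq_norm]

end ConvexNormals

/-! ### Normals to preimages of convex sets -/

section Penalty

variable {Y : Type*} [TopologicalSpace Y]

/-- The penalty method: raising the weight on `d` eventually pushes the minimizers over `t` off
the compact set `t \ s`. -/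
lemma exists_isLocalMin_add_natCast_mul {s t : Set Y} (ht : IsCompact t) (hs : IsOpen s)
    (hst : s ⊆ t) {φ d : Y → ℝ} (hφ : Continuous φ) (hd : Continuous d) (hd₀ : ∀ x, 0 ≤ d x)
    {p : Y} (hp : p ∈ s) (hdp : d p = 0) (hlt : ∀ x ∈ t \ s, d x = 0 → φ p < φ x) :
    ∃ k : ℕ, ∃ q ∈ s, IsLocalMin (fun x => φ x + k * d x) q := by
  have hcover : t \ s ⊆ ⋃ k : ℕ, {x | φ p < φ x + k * d x} := by
    intro x hx
    rw [Set.mem_iUnion]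
    rcases (hd₀ x).eq_or_lt' with hdx | hdx
    · exact ⟨0, by simpa only [Set.mem_ofPred_eq, hdx, mul_zero, add_zero] using hlt x hx hdx⟩
    · obtain ⟨k, hk⟩ := exists_nat_gt ((φ p - φ x) / d x)
      exact ⟨k, sub_lt_iff_lt_add'.1 ((div_lt_iff₀ hdx).1 hk)⟩
  have hmono : Monotone fun k : ℕ => {x | φ p < φ x + k * d x} := fun k l hkl x hx => by
    refine lt_of_lt_of_le (Set.mem_ofPred.1 hx) ?_
    gcongr
    exact hd₀ x
  obtain ⟨k, hk⟩ := (ht.diff hs).elim_directed_cover _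
    (fun k => isOpen_lt continuous_const (by fun_prop)) hcover hmono.directed_le
  refine ⟨k, ht.exists_isLocalMin_mem_open hst (z := p) (by fun_prop) (hst hp)
    (fun x hx => ?_) hs⟩
  simpa only [hdp, mul_zero, add_zero, Set.mem_ofPred_eq] using hk hx

end Penalty

section FirstOrder

variable {E : Type*} [NormedAddCommGroup E] [NormedSpace ℝ E]

lemma norm_fderiv_le_of_eventually_le {s : E → ℝ} {s' : E →L[ℝ] ℝ} {q : E} {ε : ℝ} (hε : 0 ≤ ε)
    (hs : HasFDerivAt s s' q) (hmin : ∀ᶠ x in 𝓝 q, s q ≤ s x + ε * ‖x - q‖) : ‖s'‖ ≤ ε := by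
  have hlower : ∀ d, -(ε * ‖d‖) ≤ s' d := by
    intro d
    have hslope := (hs.hasLineDerivAt d).tendsto_slope_zero_right
    refine ge_of_tendsto hslope ?_
    filter_upwards [(tendsto_add_smul_nhdsGT_zero q d).eventually hmin, self_mem_nhdsWithin]
      with t hle (ht : 0 < t)
    rw [add_sub_cancel_left, norm_smul, Real.norm_of_nonneg ht.le] at hle
    rw [smul_eq_mul, inv_mul_eq_div, le_div_iff₀ ht]
    linarith
  refine s'.opNorm_le_bound hε fun d => abs_le.2 ⟨hlower d, ?_⟩
  simpa only [norm_neg, map_neg, neg_le_neg_iff] using hlower (-d)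

end FirstOrder

section UniformInjectivity

variable {Y H K : Type*} [TopologicalSpace Y] [NormedAddCommGroup H] [NormedSpace ℝ H]
  [ProperSpace H] [NormedAddCommGroup K] [NormedSpace ℝ K] {N : Y → Set H} {A : H →L[ℝ] K} {b : Y}

lemma eventually_forall_mul_norm_le (hN : IsClosed (gph N))
    (hcone : ∀ y, ∀ η ∈ N y, ∀ r : ℝ, 0 ≤ r → r • η ∈ N y) (hker : ∀ η ∈ N b, A η = 0 → η = 0) :
    ∃ r > 0, ∀ᶠ z : (H →L[ℝ] K) × Y in 𝓝 (A, b), ∀ η ∈ N z.2, r * ‖η‖ ≤ ‖z.1 η‖ := by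
  have hopen : IsOpen {w : (ℝ × (H →L[ℝ] K) × Y) × H |
      (w.1.2.2, w.2) ∈ gph N → w.1.1 < ‖w.1.2.1 w.2‖} := by
    simp only [imp_iff_not_or, Set.ofPred_or]
    exact (hN.isOpen_compl.preimage (f := fun w : (ℝ × (H →L[ℝ] K) × Y) × H => (w.1.2.2, w.2))
      (by fun_prop)).union (isOpen_lt (by fun_prop) (by fun_prop))
  have hsphere : ∀ᶠ x : ℝ × (H →L[ℝ] K) × Y in 𝓝 (0, A, b), ∀ η ∈ Metric.sphere (0 : H) 1,
      (x.2.2, η) ∈ gph N → x.1 < ‖x.2.1 η‖ := by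
    refine (isCompact_sphere (0 : H) 1).eventually_forall_of_forall_eventually fun η hη =>
      hopen.mem_nhds fun hηN => norm_pos_iff.2 fun hAη => ?_
    exact Metric.ne_of_mem_sphere hη one_ne_zero (hker η hηN hAη)
  rw [nhds_prod_eq] at hsphere
  obtain ⟨r, hr, hr₀ : 0 < r⟩ :=
    ((hsphere.curry.filter_mono nhdsWithin_le_nhds).and self_mem_nhdsWithin).exists
      (f := 𝓝[>] (0 : ℝ))
  refine ⟨r, hr₀, hr.mono fun z hz η hη => ?_⟩
  rcases eq_or_ne η 0 with rfl | hη₀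
  · simp
  · have hunit := hz (‖η‖⁻¹ • η) (by simp [norm_smul, hη₀])
      (hcone z.2 η hη ‖η‖⁻¹ (by positivity))
    rw [map_smul, norm_smul, norm_inv, norm_norm, inv_mul_eq_div,
      lt_div_iff₀ (norm_pos_iff.2 hη₀)] at hunit
    exact hunit.le

lemma mem_image_of_tendsto_apply (hN : IsClosed (gph N))
    (hcone : ∀ y, ∀ η ∈ N y, ∀ r : ℝ, 0 ≤ r → r • η ∈ N y) (hker : ∀ η ∈ N b, A η = 0 → η = 0)
    {B : ℕ → H →L[ℝ] K} {c : ℕ → Y} {η : ℕ → H} {w : K} (hB : Tendsto B atTop (𝓝 A))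
    (hc : Tendsto c atTop (𝓝 b)) (hη : ∀ k, η k ∈ N (c k))
    (hw : Tendsto (fun k => B k (η k)) atTop (𝓝 w)) : w ∈ A '' N b := by
  obtain ⟨r, hr, hinj⟩ := eventually_forall_mul_norm_le hN hcone hker
  have hbound : ∀ᶠ k in atTop, η k ∈ Metric.closedBall (0 : H) ((‖w‖ + 1) / r) := by
    filter_upwards [(hB.prodMk_nhds hc).eventually hinj,
      hw.norm.eventually (gt_mem_nhds (lt_add_one ‖w‖))] with k hk hwk
    rw [mem_closedBall_zero_iff, le_div_iff₀' hr]
    exact (hk (η k) (hη k)).trans hwk.le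
  obtain ⟨e, -, ψ, hψ, hlim⟩ :=
    tendsto_subseq_of_frequently_bounded Metric.isBounded_closedBall hbound.frequently
  have happly : Continuous fun z : (H →L[ℝ] K) × H => z.1 z.2 := by fun_prop
  have hBη : Tendsto (fun k => B (ψ k) (η (ψ k))) atTop (𝓝 (A e)) :=
    (happly.tendsto (A, e)).comp ((hB.comp hψ.tendsto_atTop).prodMk_nhds hlim)
  exact ⟨e, hN.mem_of_tendsto ((hc.comp hψ.tendsto_atTop).prodMk_nhds hlim)
    (Eventually.of_forall fun k => hη (ψ k)),
    tendsto_nhds_unique hBη (hw.comp hψ.tendsto_atTop)⟩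

end UniformInjectivity

section Preimage

open ContinuousLinearMap (adjoint)

variable {E H : Type*} [NormedAddCommGroup E] [InnerProductSpace ℝ E]
  [NormedAddCommGroup H] [InnerProductSpace ℝ H] {C : Set H} {G : E → H} {p v : E}

lemma continuous_adjoint_fderiv [CompleteSpace E] [CompleteSpace H] (hG : ContDiff ℝ 1 G) :
    Continuous fun x => adjoint (fderiv ℝ G x) :=
  (adjoint (𝕜 := ℝ) (E := E) (F := H)).continuous.comp (hG.continuous_fderiv one_ne_zero)

lemma adjoint_fderiv_mem_regularNormalCone_preimage [CompleteSpace E] [CompleteSpace H]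
    (hG : DifferentiableAt ℝ G p) {η : H} (hη : η ∈ convexNormalCone C (G p)) :
    adjoint (fderiv ℝ G p) η ∈ regularNormalCone (G ⁻¹' C) p := by
  intro ε hε
  have hlin := (((innerSL ℝ η).hasFDerivAt.comp p hG.hasFDerivAt).isLittleO).def hε
  filter_upwards [nhdsWithin_le_nhds hlin, self_mem_nhdsWithin] with x hx hxC
  have hη' := hη (G x) hxC
  rw [inner_sub_right] at hη'
  rw [ContinuousLinearMap.adjoint_inner_left]
  simp only [Function.comp_apply, innerSL_apply_apply, ContinuousLinearMap.comp_apply,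
    Real.norm_eq_abs] at hx
  linarith [(abs_le.1 hx).1]

lemma hasGradientAt_natCast_mul_norm_sub_sq_sub_inner [CompleteSpace E] [CompleteSpace H]
    (hG : DifferentiableAt ℝ G p) (k : ℕ) (c : H) (a : E) :
    HasGradientAt (fun x => k * ‖G x - c‖ ^ 2 - inner ℝ v (x - a))
      (adjoint (fderiv ℝ G p) ((2 * k : ℝ) • (G p - c)) - v) p := by
  have hnorm := ((hG.hasFDerivAt.sub_const c).norm_sq).const_mul (k : ℝ)
  have hinner := (innerSL ℝ v).hasFDerivAt.comp p ((hasFDerivAt_id p).sub_const a)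
  refine (hnorm.sub hinner).congr_fderiv (ContinuousLinearMap.ext fun x => ?_)
  simp only [map_sub, ContinuousLinearMap.sub_comp, ContinuousLinearMap.comp_id, sub_apply,
    smul_apply, ContinuousLinearMap.comp_apply, coe_innerSL_apply, nsmul_eq_mul, Nat.cast_ofNat,
    smul_eq_mul, map_smul, InnerProductSpace.toDual_apply_apply,
    ContinuousLinearMap.adjoint_inner_left, sub_left_inj]
  ring

lemma exists_isLocalMin_of_mem_regularNormalCone [ProperSpace E] {S U : Set E} (hp : p ∈ S)
    (hv : v ∈ regularNormalCone S p) {d : E → ℝ} (hd : Continuous d) (hd₀ : ∀ x, 0 ≤ d x)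
    (hdS : ∀ x, d x = 0 ↔ x ∈ S) {ε : ℝ} (hε : 0 < ε) (hU : U ∈ 𝓝 p) :
    ∃ k : ℕ, ∃ q ∈ U, IsLocalMin (fun x => ε * ‖x - p‖ - inner ℝ v (x - p) + k * d x) q := by
  obtain ⟨δ, hδ, hreg⟩ := Metric.nhds_basis_closedBall.eventually_iff.1
    (eventually_nhdsWithin_iff.1 (hv (ε / 2) (half_pos hε)))
  have hpU : p ∈ Metric.ball p δ ∩ interior U :=
    ⟨Metric.mem_ball_self hδ, mem_interior_iff_mem_nhds.2 hU⟩
  obtain ⟨k, q, hq, hmin⟩ := exists_isLocalMin_add_natCast_mul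
    (φ := fun x => ε * ‖x - p‖ - inner ℝ v (x - p)) (isCompact_closedBall p δ)
    (Metric.isOpen_ball.inter isOpen_interior)
    (Set.inter_subset_left.trans Metric.ball_subset_closedBall) (by fun_prop) hd hd₀ hpU
    ((hdS p).2 hp) fun x hx hdx => by
      have hxp : 0 < ‖x - p‖ :=
        norm_pos_iff.2 (sub_ne_zero.2 (ne_of_mem_of_not_mem hpU hx.2).symm)
      have hinner := hreg hx.1 ((hdS x).1 hdx)
      simp only [sub_self, norm_zero, mul_zero, inner_zero_right]
      nlinarith
  exact ⟨k, q, interior_subset hq.2, hmin⟩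

lemma norm_sub_adjoint_fderiv_le_of_isLocalMin [CompleteSpace E] [CompleteSpace H] {ε : ℝ}
    (hε : 0 ≤ ε) {q : E} {c : H} (hG : DifferentiableAt ℝ G q) (hc : c ∈ C)
    (hdist : Metric.infDist (G q) C = ‖G q - c‖) {k : ℕ}
    (hmin : IsLocalMin
      (fun x => ε * ‖x - p‖ - inner ℝ v (x - p) + k * Metric.infDist (G x) C ^ 2) q) :
    ‖v - adjoint (fderiv ℝ G q) ((2 * k : ℝ) • (G q - c))‖ ≤ ε := by
  have hgrad := hasGradientAt_natCast_mul_norm_sub_sq_sub_inner (v := v) hG k c p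
  rw [norm_sub_rev, ← (InnerProductSpace.toDual ℝ E).norm_map]
  refine norm_fderiv_le_of_eventually_le hε hgrad.hasFDerivAt ?_
  filter_upwards [hmin] with x hx
  have htri : ‖x - p‖ ≤ ‖x - q‖ + ‖q - p‖ := norm_sub_le_norm_sub_add_norm_sub x q p
  have hle : (k : ℝ) * Metric.infDist (G x) C ^ 2 ≤ k * ‖G x - c‖ ^ 2 := by
    have := Metric.infDist_nonneg (x := G x) (s := C)
    gcongr
    exact dist_eq_norm (G x) c ▸ Metric.infDist_le_dist_of_mem hc
  rw [hdist] at hx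
  linarith [mul_le_mul_of_nonneg_left htri hε]

lemma exists_mem_convexNormalCone_norm_sub_adjoint_fderiv_le [ProperSpace E] [CompleteSpace H]
    (hclosed : IsClosed C) (hC : Convex ℝ C) (hG : Differentiable ℝ G) (hp : G p ∈ C)
    (hv : v ∈ regularNormalCone (G ⁻¹' C) p) {ε : ℝ} (hε : 0 < ε) :
    ∃ q : E, ∃ c : H, ∃ η ∈ convexNormalCone C c,
      dist q p < ε ∧ dist c (G p) < ε ∧ ‖v - adjoint (fderiv ℝ G q) η‖ ≤ ε := by
  have hne : C.Nonempty := ⟨G p, hp⟩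
  have hU : Metric.ball p ε ∩ G ⁻¹' Metric.ball (G p) (ε / 2) ∈ 𝓝 p :=
    inter_mem (Metric.ball_mem_nhds p hε)
      (hG.continuous.continuousAt (Metric.ball_mem_nhds (G p) (half_pos hε)))
  have hzero : ∀ x, Metric.infDist (G x) C ^ 2 = 0 ↔ x ∈ G ⁻¹' C := fun x => by
    rw [pow_eq_zero_iff two_ne_zero, ← hclosed.mem_iff_infDist_zero hne, Set.mem_preimage]
  obtain ⟨k, q, ⟨hqp, hqG⟩, hmin⟩ := exists_isLocalMin_of_mem_regularNormalCone
    (show p ∈ G ⁻¹' C from hp) hv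
    (((Metric.continuous_infDist_pt C).comp hG.continuous).pow 2) (fun x => sq_nonneg _)
    hzero hε hU
  obtain ⟨c, hc, hdist, hnormal⟩ :=
    exists_infDist_eq_norm_sub_mem_convexNormalCone hne hclosed hC (G q)
  refine ⟨q, c, _, smul_mem_convexNormalCone (by positivity) hnormal, hqp, ?_,
    norm_sub_adjoint_fderiv_le_of_isLocalMin hε.le (hG q) hc hdist hmin⟩
  have hqc : dist (G q) c ≤ dist (G q) (G p) := by
    rw [dist_eq_norm (G q) c, ← hdist]
    exact Metric.infDist_le_dist_of_mem hp
  calc dist c (G p) ≤ dist (G q) c + dist (G q) (G p) := dist_triangle_left c (G p) (G q)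
    _ ≤ dist (G q) (G p) + dist (G q) (G p) := by gcongr
    _ < ε / 2 + ε / 2 := add_lt_add hqG hqG
    _ = ε := add_halves ε

lemma limitingNormalCone_preimage_subset_image_adjoint [ProperSpace E] [ProperSpace H]
    (hclosed : IsClosed C) (hC : Convex ℝ C) (hG : ContDiff ℝ 1 G)
    (hker : ∀ η ∈ convexNormalCone C (G p), adjoint (fderiv ℝ G p) η = 0 → η = 0) :
    limitingNormalCone (G ⁻¹' C) p ⊆ adjoint (fderiv ℝ G p) '' convexNormalCone C (G p) := by
  rintro v ⟨x, ξ, hx, hξ, hmem⟩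
  choose q c η hη hqx hcx happrox using fun k : ℕ =>
    exists_mem_convexNormalCone_norm_sub_adjoint_fderiv_le hclosed hC
      (hG.differentiable one_ne_zero) (hmem k).1 (hmem k).2 (Nat.one_div_pos_of_nat (n := k))
  have hε : Tendsto (fun k : ℕ => 1 / ((k : ℝ) + 1)) atTop (𝓝 0) :=
    tendsto_one_div_add_atTop_nhds_zero_nat
  have hq : Tendsto q atTop (𝓝 p) :=
    (tendsto_iff_of_dist (squeeze_zero (fun _ => dist_nonneg) (fun k => (hqx k).le) hε)).2 hx
  have hc : Tendsto c atTop (𝓝 (G p)) :=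
    (tendsto_iff_of_dist (squeeze_zero (fun _ => dist_nonneg) (fun k => (hcx k).le) hε)).2
      ((hG.continuous.tendsto p).comp hx)
  have hv : Tendsto (fun k => adjoint (fderiv ℝ G (q k)) (η k)) atTop (𝓝 v) := by
    simpa only [sub_sub_cancel, sub_zero] using hξ.sub (squeeze_zero_norm happrox hε)
  exact mem_image_of_tendsto_apply (isClosed_gph_convexNormalCone C)
    (fun _ _ hη _ hr => smul_mem_convexNormalCone hr hη) hker
    (((continuous_adjoint_fderiv hG).tendsto p).comp hq) hc hη hv

theorem limitingNormalCone_preimage_eq_image_adjoint [ProperSpace E] [ProperSpace H]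
    (hclosed : IsClosed C) (hC : Convex ℝ C) (hG : ContDiff ℝ 1 G) (hp : G p ∈ C)
    (hker : ∀ η ∈ convexNormalCone C (G p), adjoint (fderiv ℝ G p) η = 0 → η = 0) :
    limitingNormalCone (G ⁻¹' C) p = adjoint (fderiv ℝ G p) '' convexNormalCone C (G p) :=
  (limitingNormalCone_preimage_subset_image_adjoint hclosed hC hG hker).antisymm <|
    Set.image_subset_iff.2 fun _ hη =>
      regularNormalCone_subset_limitingNormalCone (C := G ⁻¹' C) hp <|
        adjoint_fderiv_mem_regularNormalCone_preimage (hG.differentiable one_ne_zero p) hη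

end Preimage

/-! ### Epigraphs and the subdifferential chain rule -/

section Epigraph

variable {H : Type*} [NormedAddCommGroup H] {g : H → EReal}

lemma isClosed_epigraph (hg : LowerSemicontinuous g) : IsClosed (epigraph g) :=
  hg.isClosed_epigraph.preimage <| (WithLp.continuous_fst 2 H ℝ).prodMk
    (continuous_coe_real_ereal.comp (WithLp.continuous_snd 2 H ℝ))

/-- The effective domain `dom g` of an extended real-valued function. For convex `g` its normal cone
is the singular subdifferential, so the qualification condition is a condition on `dom g`. -/
def effectiveDomain (g : H → EReal) : Set H :=
  {w | g w ≠ ⊤}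

variable [InnerProductSpace ℝ H] {a : H} {r : ℝ}

lemma mem_limitingSubdifferential_iff_limitingNormalCone (ha : g a = r) {z : H} :
    z ∈ limitingSubdifferential g a ↔
      WithLp.toLp 2 (z, (-1 : ℝ)) ∈ limitingNormalCone (epigraph g) (WithLp.toLp 2 (a, r)) := by
  simp [limitingSubdifferential, ha]

lemma mem_limitingSubdifferential_iff_convexNormalCone (hg : IsConvexFun g) (ha : g a = r)
    {z : H} :
    z ∈ limitingSubdifferential g a ↔
      WithLp.toLp 2 (z, (-1 : ℝ)) ∈ convexNormalCone (epigraph g) (WithLp.toLp 2 (a, r)) := by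
  have hmem : WithLp.toLp 2 (a, r) ∈ epigraph g := ha.le
  rw [mem_limitingSubdifferential_iff_limitingNormalCone ha,
    limitingNormalCone_eq_convexNormalCone hg hmem]

lemma toLp_zero_mem_convexNormalCone_epigraph_iff {z : H} :
    WithLp.toLp 2 (z, (0 : ℝ)) ∈ convexNormalCone (epigraph g) (WithLp.toLp 2 (a, r)) ↔
      z ∈ convexNormalCone (effectiveDomain g) a := by
  constructor
  · intro h w hw
    have hle := h (WithLp.toLp 2 (w, (g w).toReal)) (EReal.le_coe_toReal hw)
    simpa [WithLp.prod_inner_apply] using hle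
  · intro h p hp
    have hdom : p.fst ∈ effectiveDomain g := ne_top_of_le_ne_top (EReal.coe_ne_top _) hp
    simpa [WithLp.prod_inner_apply] using h _ hdom

lemma singularSubdifferential_eq_convexNormalCone_effectiveDomain (hg : IsConvexFun g)
    (htop : g a ≠ ⊤) (hbot : g a ≠ ⊥) :
    singularSubdifferential g a = convexNormalCone (effectiveDomain g) a := by
  have hmem : WithLp.toLp 2 (a, (g a).toReal) ∈ epigraph g := EReal.le_coe_toReal htop
  ext z
  simp [singularSubdifferential, htop, hbot, limitingNormalCone_eq_convexNormalCone hg hmem,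
    toLp_zero_mem_convexNormalCone_epigraph_iff]

end Epigraph

section EpigraphMap

open ContinuousLinearMap (adjoint)

variable {X Z : Type*} {f₀ : X → ℝ} {u : Z}

/-- The mapping whose preimage of `epi g` is the epigraph of `f(·, u)`; through it the chain rule
becomes an instance of the formula for normals to preimages. -/
def epigraphMap [Add Z] (f₀ : X → ℝ) (F : X → Z) (u : Z) (p : WithLp 2 (X × ℝ)) :
    WithLp 2 (Z × ℝ) :=
  WithLp.toLp 2 (F p.fst + u, p.snd - f₀ p.fst)

variable [NormedAddCommGroup Z] {F : X → Z} {g : Z → EReal}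

lemma compositeFun_eq_coe {x : X} {r : ℝ} (hr : g (F x + u) = r) :
    compositeFun f₀ F g x u = ((f₀ x + r : ℝ) : EReal) := by
  rw [compositeFun, hr, EReal.coe_add]

lemma epigraph_compositeFun (f₀ : X → ℝ) (F : X → Z) (g : Z → EReal) (u : Z) :
    epigraph (fun x => compositeFun f₀ F g x u) = epigraphMap f₀ F u ⁻¹' epigraph g := by
  ext p
  change (f₀ p.fst : EReal) + g (F p.fst + u) ≤ p.snd ↔
    g (F p.fst + u) ≤ ((p.snd - f₀ p.fst : ℝ) : EReal)
  rw [EReal.coe_sub, EReal.le_sub_iff_add_le (by simp) (by simp), add_comm]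

variable [NormedAddCommGroup X] [InnerProductSpace ℝ X] [InnerProductSpace ℝ Z]
  {p : WithLp 2 (X × ℝ)} {x : X}

lemma contDiff_epigraphMap {k : WithTop ℕ∞} (hf₀ : ContDiff ℝ k f₀) (hF : ContDiff ℝ k F)
    (u : Z) : ContDiff ℝ k (epigraphMap f₀ F u) := by
  have hfst : ContDiff ℝ k fun p : WithLp 2 (X × ℝ) => p.fst := (WithLp.fstL 2 ℝ X ℝ).contDiff
  have hsnd : ContDiff ℝ k fun p : WithLp 2 (X × ℝ) => p.snd := (WithLp.sndL 2 ℝ X ℝ).contDiff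
  exact (WithLp.prodContinuousLinearEquiv 2 ℝ Z ℝ).symm.contDiff.comp
    (((hF.comp hfst).add contDiff_const).prodMk (hsnd.sub (hf₀.comp hfst)))

lemma fderiv_epigraphMap_apply (hf₀ : DifferentiableAt ℝ f₀ p.fst)
    (hF : DifferentiableAt ℝ F p.fst) (d : WithLp 2 (X × ℝ)) :
    fderiv ℝ (epigraphMap f₀ F u) p d =
      WithLp.toLp 2 (fderiv ℝ F p.fst d.fst, d.snd - fderiv ℝ f₀ p.fst d.fst) := by
  have hfst : HasFDerivAt (fun p : WithLp 2 (X × ℝ) => p.fst) (WithLp.fstL 2 ℝ X ℝ) p :=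
    (WithLp.fstL 2 ℝ X ℝ).hasFDerivAt
  have hsnd : HasFDerivAt (fun p : WithLp 2 (X × ℝ) => p.snd) (WithLp.sndL 2 ℝ X ℝ) p :=
    (WithLp.sndL 2 ℝ X ℝ).hasFDerivAt
  have hmap : HasFDerivAt (epigraphMap f₀ F u) _ p :=
    ((WithLp.prodContinuousLinearEquiv 2 ℝ Z ℝ).symm.hasFDerivAt).comp p
      (((hF.hasFDerivAt.comp p hfst).add_const u).prodMk (hsnd.sub (hf₀.hasFDerivAt.comp p hfst)))
  rw [hmap.fderiv]
  rfl

variable [CompleteSpace X] [CompleteSpace Z]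

lemma adjoint_fderiv_epigraphMap_apply (hf₀ : DifferentiableAt ℝ f₀ p.fst)
    (hF : DifferentiableAt ℝ F p.fst) (η : WithLp 2 (Z × ℝ)) :
    adjoint (fderiv ℝ (epigraphMap f₀ F u) p) η =
      WithLp.toLp 2 (adjoint (fderiv ℝ F p.fst) η.fst - η.snd • gradient f₀ p.fst, η.snd) := by
  refine ext_inner_right ℝ fun d => ?_
  rw [ContinuousLinearMap.adjoint_inner_left, fderiv_epigraphMap_apply hf₀ hF]
  simp only [WithLp.prod_inner_apply, WithLp.ofLp_fst, WithLp.ofLp_snd, RCLike.inner_apply,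
    Real.ringHom_apply, gradient, inner_sub_left, ContinuousLinearMap.adjoint_inner_left,
    real_inner_smul_left, InnerProductSpace.toDual_symm_apply]
  ring

lemma eq_zero_of_adjoint_fderiv_epigraphMap_eq_zero (hf₀ : DifferentiableAt ℝ f₀ p.fst)
    (hF : DifferentiableAt ℝ F p.fst)
    (hker : ∀ η ∈ convexNormalCone (effectiveDomain g) (F p.fst + u),
      adjoint (fderiv ℝ F p.fst) η = 0 → η = 0)
    {η : WithLp 2 (Z × ℝ)} (hη : η ∈ convexNormalCone (epigraph g) (epigraphMap f₀ F u p))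
    (hzero : adjoint (fderiv ℝ (epigraphMap f₀ F u) p) η = 0) : η = 0 := by
  obtain ⟨y, s⟩ := η
  rw [adjoint_fderiv_epigraphMap_apply hf₀ hF] at hzero
  obtain ⟨hfst, rfl : s = 0⟩ := Prod.ext_iff.1 ((WithLp.ext_iff 2).1 hzero)
  have hy : y = 0 := hker y (toLp_zero_mem_convexNormalCone_epigraph_iff.1 hη)
    (by simpa using hfst)
  rw [hy]
  rfl

end EpigraphMap

section ChainRule

open ContinuousLinearMap (adjoint)

variable {X Z : Type*} [NormedAddCommGroup X] [InnerProductSpace ℝ X] [FiniteDimensional ℝ X]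
  [NormedAddCommGroup Z] [InnerProductSpace ℝ Z] [FiniteDimensional ℝ Z]
  {f₀ : X → ℝ} {F : X → Z} {g : Z → EReal} {x : X} {u : Z}

lemma limitingSubdifferential_compositeFun_of_eq_coe (hg_lsc : LowerSemicontinuous g)
    (hg_convex : IsConvexFun g) (hf₀ : ContDiff ℝ 1 f₀) (hF : ContDiff ℝ 1 F)
    (hker : ∀ η ∈ convexNormalCone (effectiveDomain g) (F x + u),
      adjoint (fderiv ℝ F x) η = 0 → η = 0) {r : ℝ} (hr : g (F x + u) = r) :
    limitingSubdifferential (fun x' => compositeFun f₀ F g x' u) x =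
      (fun y => gradient f₀ x + adjoint (fderiv ℝ F x) y) ''
        limitingSubdifferential g (F x + u) := by
  let p : WithLp 2 (X × ℝ) := WithLp.toLp 2 (x, f₀ x + r)
  have hmap : epigraphMap f₀ F u p = WithLp.toLp 2 (F x + u, r) := by simp [epigraphMap, p]
  have hdf₀ : DifferentiableAt ℝ f₀ p.fst := hf₀.differentiable one_ne_zero x
  have hdF : DifferentiableAt ℝ F p.fst := hF.differentiable one_ne_zero x
  have hnormal := limitingNormalCone_preimage_eq_image_adjoint (isClosed_epigraph hg_lsc) hg_convex
    (contDiff_epigraphMap hf₀ hF u) (show epigraphMap f₀ F u p ∈ epigraph g from hmap ▸ hr.le)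
    fun η => eq_zero_of_adjoint_fderiv_epigraphMap_eq_zero hdf₀ hdF hker
  rw [← epigraph_compositeFun, hmap] at hnormal
  have hadjoint := adjoint_fderiv_epigraphMap_apply (u := u) hdf₀ hdF
  ext v
  rw [mem_limitingSubdifferential_iff_limitingNormalCone
    (g := fun x' => compositeFun f₀ F g x' u) (compositeFun_eq_coe hr), hnormal]
  constructor
  · rintro ⟨⟨y, s⟩, hη, hηv⟩
    rw [hadjoint] at hηv
    obtain ⟨rfl, rfl : s = -1⟩ := Prod.ext_iff.1 ((WithLp.ext_iff 2).1 hηv)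
    refine ⟨y, (mem_limitingSubdifferential_iff_convexNormalCone hg_convex hr).2 hη, ?_⟩
    simp [add_comm, p]
  · rintro ⟨y, hy, rfl⟩
    refine ⟨_, (mem_limitingSubdifferential_iff_convexNormalCone hg_convex hr).1 hy, ?_⟩
    rw [hadjoint]
    simp [add_comm, p]

theorem limitingSubdifferential_compositeFun (hg_lsc : LowerSemicontinuous g)
    (hg_convex : IsConvexFun g) (hf₀ : ContDiff ℝ 1 f₀) (hF : ContDiff ℝ 1 F)
    (hker : ∀ η ∈ convexNormalCone (effectiveDomain g) (F x + u),
      adjoint (fderiv ℝ F x) η = 0 → η = 0) :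
    limitingSubdifferential (fun x' => compositeFun f₀ F g x' u) x =
      (fun y => gradient f₀ x + adjoint (fderiv ℝ F x) y) ''
        limitingSubdifferential g (F x + u) := by
  induction hr : g (F x + u) using EReal.rec with
  | bot => simp [limitingSubdifferential, compositeFun, hr]
  | top => simp [limitingSubdifferential, compositeFun, hr]
  | coe r => exact limitingSubdifferential_compositeFun_of_eq_coe hg_lsc hg_convex hf₀ hF hker hr

end ChainRule

/-! ### The mappings `M` and `M₂` near the reference point -/

section Model

open ContinuousLinearMap (adjoint)

variable {X Z : Type*} [NormedAddCommGroup X] [InnerProductSpace ℝ X] [NormedAddCommGroup Z]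
  [InnerProductSpace ℝ Z] {f₀ : X → ℝ} {F : X → Z} {g : Z → EReal} {a : X}

/-- The mapping `(v, u) ↦ {x | v ∈ ∇f₀(x) + F'(x)ᵀ ∂g(F(x) + u)}`: this is `M` with `∂ₓ f(x, u)`
replaced by its expression from the chain rule, and `M₂` with `w` eliminated. -/
def multiplierMap [CompleteSpace X] [CompleteSpace Z] (f₀ : X → ℝ) (F : X → Z) (g : Z → EReal)
    (p : X × Z) : Set X :=
  {x | p.1 ∈ (fun y => gradient f₀ x + adjoint (fderiv ℝ F x) y) ''
    limitingSubdifferential g (F x + p.2)}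

lemma mapM₂_eq_graphicalLift [CompleteSpace X] [CompleteSpace Z] (f₀ : X → ℝ) (F : X → Z)
    (g : Z → EReal) :
    mapM₂ f₀ F g =
      graphicalLift (fun z : (X × Z) × X => F z.2 + z.1.2) (multiplierMap f₀ F g) := by
  ext ⟨v, u⟩ ⟨x, w⟩
  simp only [mapM₂, graphicalLift, multiplierMap, Set.mem_ofPred_eq, Set.mem_image,
    eq_comm (a := v), eq_sub_iff_add_eq', eq_comm (b := w)]
  exact and_congr_left fun hw => by rw [hw]

variable [FiniteDimensional ℝ X] [FiniteDimensional ℝ Z]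

lemma eventually_forall_adjoint_fderiv_eq_zero (hg_convex : IsConvexFun g) (hF : ContDiff ℝ 1 F)
    (htop : g (F a) ≠ ⊤) (hbot : g (F a) ≠ ⊥) (hCQ : QualificationCondition F g a) :
    ∀ᶠ z : X × Z in 𝓝 (a, F a), ∀ η ∈ convexNormalCone (effectiveDomain g) z.2,
      adjoint (fderiv ℝ F z.1) η = 0 → η = 0 := by
  rw [QualificationCondition,
    singularSubdifferential_eq_convexNormalCone_effectiveDomain hg_convex htop hbot] at hCQ
  obtain ⟨r, hr, hinj⟩ := eventually_forall_mul_norm_le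
    (isClosed_gph_convexNormalCone (effectiveDomain g))
    (fun _ _ hη _ hs => smul_mem_convexNormalCone hs hη) fun η hη hzero => hCQ η hzero hη
  have htendsto : Tendsto (fun z : X × Z => (adjoint (fderiv ℝ F z.1), z.2)) (𝓝 (a, F a))
      (𝓝 (adjoint (fderiv ℝ F a), F a)) :=
    ((continuous_adjoint_fderiv hF).prodMap continuous_id).tendsto (a, F a)
  filter_upwards [htendsto.eventually hinj] with z hz η hη hzero
  have hle := hz η hη
  rw [hzero, norm_zero] at hle
  exact norm_le_zero_iff.1 (nonpos_of_mul_nonpos_right hle hr)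

lemma eventually_mem_gph_mapM_iff (hf₀ : ContDiff ℝ 1 f₀) (hF : ContDiff ℝ 1 F)
    (hg_lsc : LowerSemicontinuous g) (hg_convex : IsConvexFun g) (htop : g (F a) ≠ ⊤)
    (hbot : g (F a) ≠ ⊥) (hCQ : QualificationCondition F g a) (v : X) :
    ∀ᶠ z in 𝓝 ((v, (0 : Z)), a),
      z ∈ gph (mapM (compositeFun f₀ F g)) ↔ z ∈ gph (multiplierMap f₀ F g) := by
  have htendsto : Tendsto (fun z : (X × Z) × X => (z.2, F z.2 + z.1.2)) (𝓝 ((v, 0), a))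
      (𝓝 (a, F a)) := by
    have hcont : Continuous fun z : (X × Z) × X => (z.2, F z.2 + z.1.2) := by fun_prop
    simpa only [add_zero] using hcont.tendsto ((v, 0), a)
  filter_upwards [htendsto.eventually
    (eventually_forall_adjoint_fderiv_eq_zero hg_convex hF htop hbot hCQ)] with z hker
  simp only [gph, mapM, multiplierMap, Set.mem_ofPred_eq,
    limitingSubdifferential_compositeFun hg_lsc hg_convex hf₀ hF hker]

end Model

end CompositeStability

theorem mainTheorem9_general {X Z : Type*} [NormedAddCommGroup X] [InnerProductSpace ℝ X]
    [FiniteDimensional ℝ X] [NormedAddCommGroup Z] [InnerProductSpace ℝ Z] [FiniteDimensional ℝ Z]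
    {f₀ : X → ℝ} {F : X → Z} {g : Z → EReal} {a : X} (hf₀ : ContDiff ℝ 1 f₀) (hF : ContDiff ℝ 1 F)
    (hg_lsc : LowerSemicontinuous g) (hg_convex : IsConvexFun g) (htop : g (F a) ≠ ⊤)
    (hbot : g (F a) ≠ ⊥) (hCQ : QualificationCondition F g a) (v₀ : X) :
    ∃ N ∈ 𝓝 ((v₀, (0 : Z)), a), ∀ (v : X) (u : Z) (x : X),
      ((v, u), x) ∈ N ∩ gph (mapM (compositeFun f₀ F g)) →
        ((v, u), (x, F x + u)) ∈ gph (mapM₂ f₀ F g) ∧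
        (IsolatedlyCalmAt (mapM (compositeFun f₀ F g)) (v, u) x ↔
          IsolatedlyCalmAt (mapM₂ f₀ F g) (v, u) (x, F x + u)) ∧
        (IsolatedlyCalmAround (mapM (compositeFun f₀ F g)) (v, u) x ↔
          IsolatedlyCalmAround (mapM₂ f₀ F g) (v, u) (x, F x + u)) ∧
        (AubinPropertyAt (mapM (compositeFun f₀ F g)) (v, u) x ↔
          AubinPropertyAt (mapM₂ f₀ F g) (v, u) (x, F x + u)) ∧
        (HasLipschitzLocalization (mapM (compositeFun f₀ F g)) (v, u) x ↔
          HasLipschitzLocalization (mapM₂ f₀ F g) (v, u) (x, F x + u)) := by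
  have hΦ : LocallyLipschitz fun z : (X × Z) × X => F z.2 + z.1.2 :=
    ContDiff.locallyLipschitz (𝕂 := ℝ) (by fun_prop)
  have hM := eventually_mem_gph_mapM_iff hf₀ hF hg_lsc hg_convex htop hbot hCQ v₀
  rw [mapM₂_eq_graphicalLift]
  refine ⟨_, hM.eventually_nhds, ?_⟩
  rintro v u x ⟨hloc, hx⟩
  exact ⟨mem_gph_graphicalLift_graph.2 (hloc.self_of_nhds.1 hx),
    (isolatedlyCalmAt_congr hloc).trans (isolatedlyCalmAt_graphicalLift_iff hΦ).symm,
    (isolatedlyCalmAround_congr hloc).trans (isolatedlyCalmAround_graphicalLift_iff hΦ).symm,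
    (aubinPropertyAt_congr hloc).trans (aubinPropertyAt_graphicalLift_iff hΦ).symm,
    (hasLipschitzLocalization_congr hloc).trans
      (hasLipschitzLocalization_graphicalLift_iff hΦ).symm⟩

theorem mainTheorem9 (n m : ℕ)
    (f₀ : EuclideanSpace ℝ (Fin n) → ℝ)
    (F : EuclideanSpace ℝ (Fin n) → EuclideanSpace ℝ (Fin m))
    (g : EuclideanSpace ℝ (Fin m) → EReal)
    (hf₀ : ContDiff ℝ 2 f₀) (hF : ContDiff ℝ 2 F)
    (hg_proper : IsProper g) (hg_lsc : LowerSemicontinuous g) (hg_convex : IsConvexFun g)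
    (xbar : EuclideanSpace ℝ (Fin n))
    (hxbar : xbar ∈ mapM (compositeFun f₀ F g) (0, 0))
    (hCQ : QualificationCondition F g xbar) :
    ∃ N ∈ 𝓝 (((0, 0), xbar) :
        (EuclideanSpace ℝ (Fin n) × EuclideanSpace ℝ (Fin m)) × EuclideanSpace ℝ (Fin n)),
      ∀ (v : EuclideanSpace ℝ (Fin n)) (u : EuclideanSpace ℝ (Fin m))
        (x : EuclideanSpace ℝ (Fin n)),
        ((v, u), x) ∈ N ∩ gph (mapM (compositeFun f₀ F g)) →
        ((v, u), (x, F x + u)) ∈ gph (mapM₂ f₀ F g) ∧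
        (IsolatedlyCalmAt (mapM (compositeFun f₀ F g)) (v, u) x ↔
          IsolatedlyCalmAt (mapM₂ f₀ F g) (v, u) (x, F x + u)) ∧
        (IsolatedlyCalmAround (mapM (compositeFun f₀ F g)) (v, u) x ↔
          IsolatedlyCalmAround (mapM₂ f₀ F g) (v, u) (x, F x + u)) ∧
        (AubinPropertyAt (mapM (compositeFun f₀ F g)) (v, u) x ↔
          AubinPropertyAt (mapM₂ f₀ F g) (v, u) (x, F x + u)) ∧
        (HasLipschitzLocalization (mapM (compositeFun f₀ F g)) (v, u) x ↔
          HasLipschitzLocalization (mapM₂ f₀ F g) (v, u) (x, F x + u)) := by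
  have hfin : g (F xbar) ≠ ⊤ ∧ g (F xbar) ≠ ⊥ :=
    ⟨fun h => hxbar.1 (by simp [compositeFun, h]), fun h => hxbar.2.1 (by simp [compositeFun, h])⟩
  exact mainTheorem9_general (hf₀.of_le one_le_two) (hF.of_le one_le_two) hg_lsc hg_convex
    hfin.1 hfin.2 hCQ 0
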